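/- For $n\ge 0$, let $n$ cars with preferences $\alpha=(\alpha_1,\dots,\alpha_n)\in\{1,\dots,n\}^n$ enter, in the order $1,\dots,n$, a one-way street with spots $1,\dots,n$; car $i$ parks in the first spot $p\ge\alpha_i$ that is not yet occupied, if there is one. The list $\alpha$ is a parking function if all cars are able to park, and a unit interval parking function if moreover every car $i$ parks in spot $\alpha_i$ or $\alpha_i+1$. Let $\mathrm{PF}_n$ and $\mathrm{UPF}_n$ be the sets of parking functions and of unit interval parking functions of length $n$. With $\operatorname{inv}(\alpha)=\#\{(i,j): i<j,\ \alpha_i>\alpha_j\}$, put $$\mathrm{PF}_n(q)=\sum_{\alpha\in \mathrm{PF}_n}q^{\operatorname{inv}(\alpha)},\qquad \mathrm{UPF}_n(q)=\sum_{\alpha\in \mathrm{UPF}_n}q^{\operatorname{inv}(\alpha)},$$ so that $\mathrm{PF}_0(q)=\mathrm{UPF}_0(q)=1$. Let $[n]_q=1+q+\cdots+q^{n-1}$, $[n]_q!=[1]_q[2]_q\cdots[n]_q$, and $$\exp_q(z)=\sum_{n\ge0}\frac{z^n}{[n]_q!},\qquad \operatorname{Exp}_q(z)=\sum_{n\ge0}q^{\binom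 n2}\frac{z^n}{[n]_q!}.$$ **Theorem.** As formal power series in $z$ over $\mathbb{Q}(q)$, with $q$ an indeterminate, $$\sum_{n\ge0}\mathrm{PF}_n(q)\frac{z^{n+1}}{[n]_q!}=\bigl(z\operatorname{Exp}_q(-z)\bigr)^{\langle-1\rangle}\qquad\text{and}\qquad \sum_{n\ge0}\mathrm{UPF}_n(q)\frac{z^n}{[n]_q!}=\frac1{2-\exp_q(z)},$$ where $F^{\langle-1\rangle}$ denotes the compositional inverse of $F$, that is, the power series $G$ without constant term such that $F(G(z))=G(F(z))=z$. These identities are $q$-analogues of the following ones, which also hold, as formal power series in $z$ over $\mathbb{Q}$: $$\sum_{n\ge0}|\mathrm{PF}_n|\frac{z^{n+1}}{n!}=\bigl(ze^{-z}\bigr)^{\langle-1\rangle}\qquad\text{and}\qquad \sum_{n\ge0}|\mathrm{UPF}_n|\frac{z^n}{n!}=\frac1{2-e^z}.$$ -/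

import Mathlib

open PowerSeries

namespace ParkingFunctions

noncomputable section

/-- Spots, cars and preferences are indexed from `0`: both the `n` cars and the `n` spots are
`Fin n`, and a preference list is `α : Fin n → Fin n`.  `IsParking α s` says that when the cars
`0, 1, …, n - 1` arrive in this order, every car manages to park, and car `i` parks in spot `s i`:
the first spot at or after its preferred spot `α i` that no earlier car has taken.
(There is at most one such `s`; it is the inverse of the outcome permutation.) -/
def IsParking {n : ℕ} (α s : Fin n → Fin n) : Prop :=
  ∀ i, IsLeast {p : Fin n | α i ≤ p ∧ ∀ j < i, s j ≠ p} (s i)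

/-- `α` is a parking function: all cars are able to park. -/
def IsPF {n : ℕ} (α : Fin n → Fin n) : Prop :=
  ∃ s, IsParking α s

/-- `α` is a unit interval parking function: all cars are able to park, each of them in its
preferred spot or in the spot right after it. -/
def IsUPF {n : ℕ} (α : Fin n → Fin n) : Prop :=
  ∃ s, IsParking α s ∧ ∀ i, (s i : ℕ) ≤ (α i : ℕ) + 1

open scoped Classical in
/-- The set of parking functions of length `n`. -/
def PF (n : ℕ) : Finset (Fin n → Fin n) :=
  Finset.univ.filter IsPF

open scoped Classical in
/-- The set of unit interval parking functions of length `n`. -/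
def UPF (n : ℕ) : Finset (Fin n → Fin n) :=
  Finset.univ.filter IsUPF

/-- The number of inversions of a word: pairs of positions `i < j` with `w i > w j`. -/
def inv {n : ℕ} (w : Fin n → Fin n) : ℕ :=
  (Finset.univ.filter fun p : Fin n × Fin n => p.1 < p.2 ∧ w p.2 < w p.1).card

/-- The inversion enumerator of parking functions, a polynomial in `q`.  For `n = 0` it is `1`
(the empty word is the only parking function of length `0`). -/
def PFpoly (n : ℕ) : Polynomial ℤ :=
  ∑ α ∈ PF n, Polynomial.X ^ inv α

/-- The inversion enumerator of unit interval parking functions, a polynomial in `q`.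
For `n = 0` it is `1`. -/
def UPFpoly (n : ℕ) : Polynomial ℤ :=
  ∑ α ∈ UPF n, Polynomial.X ^ inv α

/-- The `q`-number `[n]_q = 1 + q + ⋯ + q ^ (n - 1)`. -/
def qNumber {K : Type*} [Field K] (q : K) (n : ℕ) : K :=
  ∑ i ∈ Finset.range n, q ^ i

/-- The `q`-factorial `[n]_q! = [1]_q [2]_q ⋯ [n]_q`. -/
def qFactorial {K : Type*} [Field K] (q : K) (n : ℕ) : K :=
  ∏ i ∈ Finset.range n, qNumber q (i + 1)

/-- `exp_q(z) = ∑ zⁿ / [n]_q!`. -/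
def qexp {K : Type*} [Field K] (q : K) : K⟦X⟧ :=
  PowerSeries.mk fun n => 1 / qFactorial q n

/-- `Exp_q(z) = ∑ q ^ (n choose 2) zⁿ / [n]_q!`. -/
def qExp {K : Type*} [Field K] (q : K) : K⟦X⟧ :=
  PowerSeries.mk fun n => q ^ n.choose 2 / qFactorial q n

/-- `G` is the compositional inverse of `F`: both have zero constant term (so that each can be
substituted into the other), and `F(G(z)) = z` and `G(F(z)) = z`. -/
def IsCompInverse {K : Type*} [Field K] (G F : K⟦X⟧) : Prop :=
  constantCoeff F = 0 ∧ constantCoeff G = 0 ∧ F.subst G = (X : K⟦X⟧) ∧ G.subst F = (X : K⟦X⟧)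

end

end ParkingFunctions

namespace ParkingFunctions

/-! ### The `q`-exponentials, and weighted sums over content vectors. -/

section Algebra

variable {K : Type*} [Field K]

/-! Both enumerators become sums over words restricted only by their content. A list parks exactly
when its content is a ballot content (`isPF_iff`); unit interval parking functions correspond, with
`inv` preserved, to words of ranking content (`rankingPref`). Words of content `m` have inversion
enumerator `[n]_q! / ∏ [m_a]_q!` (`sum_wordInv_content`), so after division by `[n]_q!` each content
has weight `∏ e (m a)`, where `e i` is the `i`-th coefficient of `E = exp_q`. These sums are
evaluated by splitting off the multiplicity of the smallest letter. The ballot recursion is that of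
the coefficients of powers of the series `G` with `G = z E(G)` (`contentSum_ballot`); since
`exp_q(z) Exp_q(-z) = 1`, this `G` inverts `z Exp_q(-z)`. The ranking recursion says `U E = 2 U -
1`, so `U = 1 / (2 - E)`. Only nonvanishing `q`-factorials are needed, so `q` may be the
indeterminate or `1`. -/

theorem qNumber_add (q : K) (m n : ℕ) :
    qNumber q (m + n) = qNumber q m + q ^ m * qNumber q n := by
  simp only [qNumber, Finset.sum_range_add, Finset.mul_sum, pow_add]

theorem qNumber_zero (q : K) : qNumber q 0 = 0 := by simp [qNumber]

theorem qFactorial_zero (q : K) : qFactorial q 0 = 1 := by simp [qFactorial]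

theorem qFactorial_succ (q : K) (n : ℕ) :
    qFactorial q (n + 1) = qFactorial q n * qNumber q (n + 1) := by
  simp [qFactorial, Finset.prod_range_succ]

theorem qNumber_ne_zero {q : K} (hq : ∀ n, qFactorial q n ≠ 0) (n : ℕ) :
    qNumber q (n + 1) ≠ 0 := by
  have := hq (n + 1)
  rw [qFactorial_succ] at this
  exact right_ne_zero_of_mul this

/-- Multiply the coefficient of degree `i + j` by `[i + j]_q = [j]_q + q^j [i]_q`: after an index
shift the two resulting sums cancel term by term. -/
theorem qexp_mul_rescale_qExp {q : K} (hq : ∀ n, qFactorial q n ≠ 0) :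
    qexp q * rescale (-1) (qExp q) = 1 := by
  ext n
  rw [coeff_mul, coeff_one]
  simp only [qexp, qExp, coeff_rescale, coeff_mk]
  rcases n with _ | n
  · simp [qFactorial_zero]
  rw [if_neg (Nat.succ_ne_zero n)]
  set t : ℕ → ℕ → K := fun i j =>
    1 / qFactorial q i * ((-1) ^ j * (q ^ j.choose 2 / qFactorial q j)) with ht
  have h : qNumber q (n + 1) * ∑ p ∈ Finset.HasAntidiagonal.antidiagonal (n + 1), t p.1 p.2 =
      ∑ p ∈ Finset.HasAntidiagonal.antidiagonal (n + 1), qNumber q p.2 * t p.1 p.2 +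
      ∑ p ∈ Finset.HasAntidiagonal.antidiagonal (n + 1), q ^ p.2 * qNumber q p.1 * t p.1 p.2 := by
    rw [Finset.mul_sum, ← Finset.sum_add_distrib]
    refine Finset.sum_congr rfl fun p hp => ?_
    rw [← add_mul, ← qNumber_add, add_comm p.2, Finset.HasAntidiagonal.mem_antidiagonal.mp hp]
  refine (mul_eq_zero.mp (?_ : qNumber q (n + 1) * _ = 0)).resolve_left (qNumber_ne_zero hq n)
  rw [h, Finset.Nat.sum_antidiagonal_succ', Finset.Nat.sum_antidiagonal_succ]
  simp only [qNumber_zero, zero_mul, mul_zero, zero_add]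
  rw [← Finset.sum_add_distrib]
  refine Finset.sum_eq_zero fun p _ => ?_
  have h1 := hq p.1
  have h2 := hq p.2
  have h3 := qNumber_ne_zero hq p.1
  have h4 := qNumber_ne_zero hq p.2
  simp only [ht, qFactorial_succ, Nat.choose_succ_succ' p.2 1, Nat.choose_one_right, pow_add]
  field_simp
  ring

theorem coeff_subst_eq_sum_range {F G : K⟦X⟧} (hG : constantCoeff G = 0) (n : ℕ) :
    coeff n (F.subst G) = ∑ d ∈ Finset.range (n + 1), coeff d F * coeff n (G ^ d) := by
  rw [coeff_subst' (HasSubst.of_constantCoeff_zero' hG),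
    finsum_eq_sum_of_support_subset (s := Finset.range (n + 1))]
  · rfl
  · intro d hd
    simp only [Finset.coe_range, Set.mem_Iio]
    by_contra! hlt
    refine hd ?_
    have : X ^ d ∣ G ^ d := pow_dvd_pow_of_dvd (X_dvd_iff.mpr hG) d
    simp only [X_pow_dvd_iff.mp this n (by omega), smul_zero]

theorem sum_antidiagonalTuple_succ {k t : ℕ} (f : (Fin (k + 1) → ℕ) → K) :
    ∑ m ∈ Finset.Nat.antidiagonalTuple (k + 1) t, f m =
      ∑ j ∈ Finset.range (t + 1), ∑ m ∈ Finset.Nat.antidiagonalTuple k j,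
        f (Fin.cons (t - j) m) := by
  rw [Finset.sum_sigma']
  symm
  refine Finset.sum_bij' (fun p _ => Fin.cons (t - p.1) p.2)
    (fun m _ => ⟨∑ i, Fin.tail m i, Fin.tail m⟩) ?_ ?_ ?_ ?_ ?_
  · rintro ⟨j, m⟩ h
    simp only [Finset.mem_sigma, Finset.mem_range, Finset.Nat.mem_antidiagonalTuple] at h
    simp only [Finset.Nat.mem_antidiagonalTuple, Fin.sum_univ_succ, Fin.cons_zero, Fin.cons_succ]
    omega
  · intro m h
    simp only [Finset.Nat.mem_antidiagonalTuple, Fin.sum_univ_succ] at h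
    simp only [Finset.mem_sigma, Finset.mem_range, Finset.Nat.mem_antidiagonalTuple, Fin.tail,
      and_true]
    omega
  · rintro ⟨j, m⟩ h
    simp only [Finset.mem_sigma, Finset.Nat.mem_antidiagonalTuple] at h
    obtain ⟨_, rfl⟩ := h
    simp
  · intro m h
    simp only [Finset.Nat.mem_antidiagonalTuple, Fin.sum_univ_succ] at h
    have : t - ∑ i, Fin.tail m i = m 0 := by simp only [Fin.tail]; omega
    simp only [this, Fin.cons_self_tail]
  · intros; rfl

/-- The content condition for parking functions: at most `k - 1 - i` letters exceed `i`. -/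
def IsBallotContent {k : ℕ} (m : Fin k → ℕ) : Prop :=
  ∀ i : Fin k, (i : ℕ) + 1 + ∑ b ∈ Finset.Ioi i, m b ≤ k

/-- The content condition for Fubini rankings: if the letter `a` occurs, then exactly `k - a`
letters are at least `a`. -/
def IsRankingContent {k : ℕ} (m : Fin k → ℕ) : Prop :=
  ∀ a : Fin k, m a ≠ 0 → (a : ℕ) + ∑ b ∈ Finset.Ici a, m b = k

theorem isBallotContent_cons {k : ℕ} (c : ℕ) (m : Fin k → ℕ) :
    IsBallotContent (Fin.cons c m : Fin (k + 1) → ℕ) ↔ ∑ b, m b ≤ k ∧ IsBallotContent m := by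
  unfold IsBallotContent
  rw [Fin.forall_fin_succ]
  refine and_congr ?_ (forall_congr' fun i => ?_)
  · rw [Fin.Ioi_zero_eq_map, Finset.sum_map]
    simp only [Fin.val_zero, Fin.coe_succEmb, Fin.cons_succ]
    omega
  · rw [← Fin.map_succEmb_Ioi, Finset.sum_map]
    simp only [Fin.val_succ, Fin.coe_succEmb, Fin.cons_succ]
    omega

theorem isRankingContent_cons {k : ℕ} (c : ℕ) (m : Fin k → ℕ) :
    IsRankingContent (Fin.cons c m : Fin (k + 1) → ℕ) ↔
      (c ≠ 0 → c + ∑ b, m b = k + 1) ∧ IsRankingContent m := by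
  unfold IsRankingContent
  rw [Fin.forall_fin_succ]
  refine and_congr ?_ (forall_congr' fun i => ?_)
  · have : Finset.Ici (0 : Fin (k + 1)) = Finset.univ := by ext; simp
    rw [this, Fin.sum_univ_succ]
    simp
  · rw [← Fin.map_succEmb_Ici, Finset.sum_map]
    simp only [Fin.val_succ, Fin.coe_succEmb, Fin.cons_succ]
    refine imp_congr_right fun _ => ?_
    omega

open scoped Classical in
/-- The sum of `∏ e (m b)` over the contents `m` of total `t` which satisfy `P`. -/
noncomputable def contentSum (e : ℕ → K) {k : ℕ} (P : (Fin k → ℕ) → Prop) (t : ℕ) : K :=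
  ∑ m ∈ Finset.Nat.antidiagonalTuple k t with P m, ∏ b, e (m b)

theorem contentSum_ballot_succ (e : ℕ → K) (k t : ℕ) :
    contentSum e (IsBallotContent (k := k + 1)) t =
      ∑ j ∈ Finset.range (t + 1), if j ≤ k then
        e (t - j) * contentSum e (IsBallotContent (k := k)) j else 0 := by
  classical
  unfold contentSum
  rw [Finset.sum_filter, sum_antidiagonalTuple_succ]
  refine Finset.sum_congr rfl fun j _ => ?_
  rw [Finset.sum_filter, Finset.mul_sum, ← Finset.sum_const_zero, ← Finset.sum_ite_irrel]
  refine Finset.sum_congr rfl fun m hm => ?_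
  rw [Finset.Nat.mem_antidiagonalTuple] at hm
  rw [isBallotContent_cons, hm]
  by_cases h1 : j ≤ k <;> by_cases h2 : IsBallotContent m <;>
    simp [h1, h2, Fin.prod_univ_succ]

theorem contentSum_ranking_succ (e : ℕ → K) (k t : ℕ) :
    contentSum e (IsRankingContent (k := k + 1)) t =
      ∑ j ∈ Finset.range (t + 1), if j = t ∨ t = k + 1 then
        e (t - j) * contentSum e (IsRankingContent (k := k)) j else 0 := by
  classical
  unfold contentSum
  rw [Finset.sum_filter, sum_antidiagonalTuple_succ]
  refine Finset.sum_congr rfl fun j hj => ?_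
  rw [Finset.mem_range] at hj
  rw [Finset.sum_filter, Finset.mul_sum, ← Finset.sum_const_zero, ← Finset.sum_ite_irrel]
  refine Finset.sum_congr rfl fun m hm => ?_
  rw [Finset.Nat.mem_antidiagonalTuple] at hm
  have : (t - j ≠ 0 → t - j + j = k + 1) ↔ (j = t ∨ t = k + 1) := by omega
  rw [isRankingContent_cons, hm, this]
  by_cases h1 : j = t ∨ t = k + 1 <;> by_cases h2 : IsRankingContent m <;>
    simp [h1, h2, Fin.prod_univ_succ]

theorem contentSum_zero (e : ℕ → K) (t : ℕ) {P : (Fin 0 → ℕ) → Prop} (hP : ∀ m, P m) :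
    contentSum e P t = if t = 0 then 1 else 0 := by
  classical
  unfold contentSum
  rcases t with _ | t <;> simp [hP]

/-- Only `t = k` is used later; general `t` makes the induction close. From `G ^ (h + 1) = z · (z ^
h E)(G)`, comparing coefficients gives the recursion `contentSum_ballot_succ`, with `h = k - t`
measuring the slack. -/
theorem contentSum_ballot {E G : K⟦X⟧} (hE : constantCoeff E = 1) (hG : constantCoeff G = 0)
    (hGE : G = X * E.subst G) (k t : ℕ) (htk : t ≤ k) :
    contentSum (fun i => coeff i E) (IsBallotContent (k := k)) t =
      coeff (k + 1) (G ^ (k - t + 1)) := by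
  have hs := HasSubst.of_constantCoeff_zero' hG
  have hstep (n h : ℕ) : coeff (n + 1) (G ^ (h + 1)) =
      ∑ d ∈ Finset.range (n + 1), coeff d (X ^ h * E) * coeff n (G ^ d) := by
    rw [← coeff_subst_eq_sum_range hG, subst_mul hs, subst_pow hs, subst_X hs, pow_succ]
    nth_rewrite 2 [hGE]
    rw [mul_left_comm, coeff_succ_X_mul]
  induction k generalizing t with
  | zero =>
    obtain rfl : t = 0 := by omega
    rw [contentSum_zero _ _ (P := IsBallotContent) (fun _ i => Fin.elim0 i), hstep]
    simp [hE]
  | succ k ih =>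
    rw [contentSum_ballot_succ, hstep,
      -- The exponent `d` corresponds to `j = k + 1 - d`; the term `d = 0` vanishes because `G ^ 0`
      -- has no coefficient in positive degree.
      ← Finset.sum_range_reflect (fun d => coeff d (X ^ (k + 1 - t) * E) * _),
      Finset.sum_range_succ _ (k + 1)]
    simp only [Nat.add_sub_cancel, Nat.sub_self, pow_zero, coeff_one, Nat.succ_ne_zero, if_false,
      mul_zero, add_zero]
    rw [← Finset.sum_filter]
    have hsub : (Finset.range (t + 1)).filter (· ≤ k) ⊆ Finset.range (k + 1) := by
      intro j hj
      simp only [Finset.mem_filter, Finset.mem_range] at hj ⊢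
      omega
    rw [← Finset.sum_subset hsub]
    · refine Finset.sum_congr rfl fun j hj => ?_
      simp only [Finset.mem_filter, Finset.mem_range] at hj
      rw [ih j hj.2, coeff_X_pow_mul', if_pos (by omega)]
      congr 3 <;> omega
    · intro j hj hj'
      simp only [Finset.mem_filter, Finset.mem_range] at hj hj'
      rw [coeff_X_pow_mul', if_neg (by omega), zero_mul]

theorem contentSum_ranking_of_lt (e : ℕ → K) {k t : ℕ} (h : k < t) :
    contentSum e (IsRankingContent (k := k)) t = 0 := by
  induction k generalizing t with
  | zero => rw [contentSum_zero _ _ (P := IsRankingContent) (fun _ i => Fin.elim0 i), if_neg (by omega)]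
  | succ k ih =>
    rw [contentSum_ranking_succ]
    refine Finset.sum_eq_zero fun j _ => ?_
    split_ifs with hj
    · rw [ih (by omega), mul_zero]
    · rfl

theorem contentSum_ranking_of_le {e : ℕ → K} (he : e 0 = 1) {k t : ℕ} (h : t ≤ k) :
    contentSum e (IsRankingContent (k := k)) t = contentSum e (IsRankingContent (k := t)) t := by
  induction k, h using Nat.le_induction with
  | base => rfl
  | succ k hk ih =>
    rw [contentSum_ranking_succ, Finset.sum_eq_single t]
    · simp [he, ih]
    · intro j _ hj
      exact if_neg (by omega)
    · simp

theorem mk_contentSum_ranking {E : K⟦X⟧} (hE : constantCoeff E = 1) :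
    (mk fun n => contentSum (fun i => coeff i E) (IsRankingContent (k := n)) n) =
      (2 - E)⁻¹ := by
  have he : coeff 0 E = 1 := by simpa using hE
  set U : K⟦X⟧ := mk fun n => contentSum (fun i => coeff i E) (IsRankingContent (k := n)) n
  have h0 : constantCoeff (2 - E) ≠ 0 := by
    rw [map_sub, hE, map_ofNat]; norm_num
  rw [PowerSeries.eq_inv_iff_mul_eq_one h0, mul_sub, mul_two, sub_eq_iff_eq_add']
  -- For `t = k + 1` the recursion allows every `j`, so it is a convolution with `E` lacking only
  -- the term `e 0`; that term supplies the second `U`.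
  have key : U * E = U + U - 1 := by
    ext n
    rw [coeff_mul, Finset.Nat.sum_antidiagonal_eq_sum_range_succ_mk, Finset.sum_range_succ _ n]
    simp only [U, coeff_mk, map_sub, map_add, Nat.sub_self, he, mul_one, coeff_one]
    rcases n with _ | n
    · simp [contentSum_zero _ _ (P := IsRankingContent (k := 0)) (fun _ i => Fin.elim0 i)]
    · rw [if_neg (Nat.succ_ne_zero n), sub_zero, add_left_inj, contentSum_ranking_succ,
        Finset.sum_range_succ _ (n + 1), contentSum_ranking_of_lt _ (Nat.lt_succ_self n)]
      simp only [or_true, if_true, mul_zero, add_zero]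
      refine Finset.sum_congr rfl fun j hj => ?_
      rw [contentSum_ranking_of_le he (k := n) (by simp at hj; omega), mul_comm]
  rw [key]; ring

theorem isCompInverse_mk_contentSum_ballot {E E' : K⟦X⟧} (hE : constantCoeff E = 1)
    (hEE' : E * E' = 1) :
    IsCompInverse
      (X * mk fun n => contentSum (fun i => coeff i E) (IsBallotContent (k := n)) n) (X * E') := by
  have hE' : constantCoeff E' = 1 := by
    have := congrArg constantCoeff hEE'
    simpa [hE] using this
  set F := X * E' with hF
  have hF0 : constantCoeff F = 0 := by simp [hF]
  have hF1 : IsUnit (coeff 1 F) := by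
    have : coeff 1 F = 1 := by rw [hF, ← zero_add 1, coeff_succ_X_mul]; simpa using hE'
    rw [this]; exact isUnit_one
  let _ := hF1.invertible
  have hG0 : constantCoeff F.substInv = 0 := constantCoeff_substInv F
  have hs := HasSubst.of_constantCoeff_zero' hG0
  have hFG := subst_substInv_right F hF0
  have hGF := subst_substInv_left F hF0
  -- Multiply `G · E'(G) = X` by `E(G)`, the inverse of `E'(G)`.
  have hGE : F.substInv = X * E.subst F.substInv := by
    have h1 : F.substInv * E'.subst F.substInv = X := by
      have h := hFG
      change (X * E').subst F.substInv = X at h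
      rwa [subst_mul hs, subst_X hs] at h
    have h2 : E.subst F.substInv * E'.subst F.substInv = 1 := by
      rw [← subst_mul hs, hEE', ← coe_substAlgHom hs, map_one]
    calc F.substInv = F.substInv * (E.subst F.substInv * E'.subst F.substInv) := by
          rw [h2, mul_one]
      _ = F.substInv * E'.subst F.substInv * E.subst F.substInv := by ring
      _ = _ := by rw [h1]
  have : (X * mk fun n => contentSum (fun i => coeff i E) (IsBallotContent (k := n)) n) =
      F.substInv := by
    ext n
    rcases n with _ | n
    · simp [hG0]
    · rw [coeff_succ_X_mul, coeff_mk, contentSum_ballot hE hG0 hGE n n le_rfl]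
      simp
  rw [this]
  exact ⟨hF0, hG0, hFG, hGF⟩

end Algebra

/-! ### Inversions of words with prescribed content. -/

section Words

/-- The number of occurrences of each letter in a word. -/
def content {n k : ℕ} (w : Fin n → Fin k) (a : Fin k) : ℕ :=
  (Finset.univ.filter fun i => w i = a).card

/-- The number of inversions of a word of length `n` in `k` letters. -/
def wordInv {n k : ℕ} (w : Fin n → Fin k) : ℕ :=
  (Finset.univ.filter fun p : Fin n × Fin n => p.1 < p.2 ∧ w p.2 < w p.1).card

theorem sum_content {n k : ℕ} (w : Fin n → Fin k) (s : Finset (Fin k)) :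
    ∑ a ∈ s, content w a = (Finset.univ.filter fun i => w i ∈ s).card := by
  simp only [content, Finset.card_filter]
  rw [Finset.sum_comm]
  simp

theorem sum_univ_content {n k : ℕ} (w : Fin n → Fin k) : ∑ a, content w a = n := by
  simp [sum_content]

theorem content_cons {n k : ℕ} (a : Fin k) (w : Fin n → Fin k) :
    content (Fin.cons a w : Fin (n + 1) → Fin k) = content w + Pi.single a 1 := by
  ext b
  simp only [content, Finset.card_filter, Fin.sum_univ_succ, Fin.cons_zero, Fin.cons_succ,
    Pi.add_apply, Pi.single_apply, eq_comm (a := b)]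
  omega

theorem wordInv_cons {n k : ℕ} (a : Fin k) (w : Fin n → Fin k) :
    wordInv (Fin.cons a w : Fin (n + 1) → Fin k) =
      ∑ b ∈ Finset.Iio a, content w b + wordInv w := by
  rw [sum_content]
  simp only [wordInv, Finset.card_filter, Fintype.sum_prod_type, Fin.sum_univ_succ, Fin.cons_zero,
    Fin.cons_succ, Fin.succ_lt_succ_iff, Finset.mem_Iio]
  simp

variable {K : Type*} [Field K]

theorem sum_pow_mul_qNumber (q : K) {k : ℕ} (m : Fin k → ℕ) :
    ∑ a, q ^ (∑ b ∈ Finset.Iio a, m b) * qNumber q (m a) = qNumber q (∑ a, m a) := by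
  induction k with
  | zero => simp [qNumber]
  | succ k ih =>
    rw [Fin.sum_univ_castSucc, Fin.sum_univ_castSucc (f := m), qNumber_add, ← ih]
    congr 1
    · refine Finset.sum_congr rfl fun a _ => ?_
      rw [← Fin.map_castSuccEmb_Iio, Finset.sum_map]
      rfl
    · rw [Fin.Iio_last_eq_map, Finset.sum_map]
      rfl

open scoped Classical in
/-- The inversion enumerator of the words of a given content is a `q`-multinomial coefficient. -/
theorem sum_wordInv_content (q : K) {n k : ℕ} (m : Fin k → ℕ) (hm : ∑ a, m a = n) :
    (∑ w : Fin n → Fin k with content w = m, q ^ wordInv w) * ∏ a, qFactorial q (m a) =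
      qFactorial q n := by
  induction n generalizing m with
  | zero =>
    have hm0 : m = 0 := by
      ext a
      exact (Finset.sum_eq_zero_iff.mp hm) a (Finset.mem_univ a)
    subst hm0
    have (w : Fin 0 → Fin k) : content w = 0 := by ext; simp [content]
    simp [this, wordInv, qFactorial_zero]
  | succ n ih =>
    -- Split by the first letter `a`: it makes one inversion with each smaller letter, which is the
    -- power of `q` in this decomposition.
    have hn : qNumber q (n + 1) = ∑ a, q ^ (∑ b ∈ Finset.Iio a, m b) * qNumber q (m a) := by
      rw [sum_pow_mul_qNumber, hm]
    rw [Finset.sum_filter, ← (Fin.consEquiv fun _ => Fin k).sum_comp, Fintype.sum_prod_type,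
      Finset.sum_mul, qFactorial_succ, hn, Finset.mul_sum]
    refine Finset.sum_congr rfl fun a _ => ?_
    simp only [Fin.consEquiv, Equiv.coe_fn_mk, content_cons, wordInv_cons]
    rcases Nat.eq_zero_or_pos (m a) with h0 | hpos
    · rw [h0, qNumber_zero, mul_zero, mul_zero, Finset.sum_eq_zero, zero_mul]
      intro w _
      refine if_neg fun h => ?_
      have := congrFun h a
      simp [h0] at this
    obtain ⟨m', rfl⟩ : ∃ m' : Fin k → ℕ, m = m' + Pi.single a 1 := by
      refine ⟨m - Pi.single a 1, (tsub_add_cancel_of_le ?_).symm⟩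
      intro b
      rw [Pi.single_apply]
      split_ifs with h
      · rw [h]; exact hpos
      · exact Nat.zero_le _
    have hm' : ∑ b, m' b = n := by
      simp only [Pi.add_apply, Finset.sum_add_distrib, Finset.sum_pi_single', Finset.mem_univ,
        if_true] at hm
      omega
    have hIio : ∑ b ∈ Finset.Iio a, (m' + Pi.single a 1 : Fin k → ℕ) b = ∑ b ∈ Finset.Iio a, m' b := by
      refine Finset.sum_congr rfl fun b hb => ?_
      simp [(Finset.mem_Iio.mp hb).ne]
    have hprod : ∏ b, qFactorial q ((m' + Pi.single a 1 : Fin k → ℕ) b) =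
        (∏ b, qFactorial q (m' b)) * qNumber q (m' a + 1) := by
      rw [← Finset.mul_prod_erase _ _ (Finset.mem_univ a),
        ← Finset.mul_prod_erase _ (fun b => qFactorial q (m' b)) (Finset.mem_univ a)]
      have : ∏ b ∈ Finset.univ.erase a, qFactorial q ((m' + Pi.single a 1 : Fin k → ℕ) b) =
          ∏ b ∈ Finset.univ.erase a, qFactorial q (m' b) := by
        refine Finset.prod_congr rfl fun b hb => ?_
        simp [Finset.ne_of_mem_erase hb]
      rw [this]
      simp only [Pi.add_apply, Pi.single_eq_same, qFactorial_succ]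
      ring
    rw [hIio, hprod, ← ih m' hm']
    simp only [add_left_inj, Pi.add_apply, Pi.single_eq_same]
    have : ∑ w : Fin n → Fin k, (if content w = m' then
        q ^ (∑ b ∈ Finset.Iio a, content w b + wordInv w) else 0) =
        q ^ (∑ b ∈ Finset.Iio a, m' b) * ∑ w : Fin n → Fin k with content w = m', q ^ wordInv w := by
      rw [Finset.sum_filter, Finset.mul_sum]
      refine Finset.sum_congr rfl fun w _ => ?_
      split_ifs with h
      · rw [h, pow_add]
      · simp
    rw [this]
    ring

open scoped Classical in
theorem sum_wordInv_div_qFactorial {q : K} (hq : ∀ n, qFactorial q n ≠ 0) {n k : ℕ}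
    (P : (Fin k → ℕ) → Prop) :
    (∑ w : Fin n → Fin k with P (content w), q ^ wordInv w) / qFactorial q n =
      contentSum (fun i => 1 / qFactorial q i) P n := by
  rw [contentSum, ← Finset.sum_fiberwise_of_maps_to (g := content)
    (t := (Finset.Nat.antidiagonalTuple k n).filter P), Finset.sum_div]
  · refine Finset.sum_congr rfl fun m hm => ?_
    simp only [Finset.mem_filter, Finset.Nat.mem_antidiagonalTuple] at hm
    rw [Finset.filter_filter]
    have : (Finset.univ.filter fun w : Fin n → Fin k => P (content w) ∧ content w = m) =
        Finset.univ.filter fun w => content w = m := by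
      refine Finset.filter_congr fun w _ => and_iff_right_of_imp ?_
      rintro rfl
      exact hm.2
    rw [this, div_eq_iff (hq n), ← sum_wordInv_content q m hm.1, mul_left_comm,
      ← Finset.prod_mul_distrib]
    simp [hq]
  · intro w hw
    simp only [Finset.mem_filter, Finset.Nat.mem_antidiagonalTuple] at hw ⊢
    exact ⟨sum_univ_content w, hw.2⟩

end Words

/-! ### Parking functions and the ballot condition. -/

section Parking

variable {n : ℕ} {α s : Fin n → Fin n}

theorem IsParking.le (h : IsParking α s) (i : Fin n) : α i ≤ s i := (h i).1.1

theorem IsParking.injective (h : IsParking α s) : Function.Injective s := by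
  intro i j hij
  rcases lt_trichotomy i j with hlt | heq | hlt
  · exact absurd hij ((h j).1.2 i hlt)
  · exact heq
  · exact absurd hij.symm ((h i).1.2 j hlt)

theorem IsParking.surjective (h : IsParking α s) : Function.Surjective s :=
  Finite.surjective_of_injective h.injective

theorem IsParking.unique {s' : Fin n → Fin n} (h : IsParking α s) (h' : IsParking α s') :
    s = s' := by
  funext i
  induction i using WellFoundedLT.induction with
  | _ i ih =>
    have heq : {p : Fin n | α i ≤ p ∧ ∀ j < i, s j ≠ p} =
        {p : Fin n | α i ≤ p ∧ ∀ j < i, s' j ≠ p} := by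
      ext p
      refine and_congr_right fun _ => forall₂_congr fun j hj => ?_
      rw [ih j hj]
    have := h i
    rw [heq] at this
    exact this.unique (h' i)

theorem exists_isLeast_of_nonempty {S : Set (Fin n)} (hS : S.Nonempty) : ∃ p, IsLeast S p := by
  obtain ⟨p, hp⟩ := (Set.toFinite S).exists_minimal hS
  exact ⟨p, hp.prop, fun x hx => (le_total p x).elim id (hp.le_of_le hx)⟩

theorem IsPF.isBallotContent (h : IsPF α) : IsBallotContent (content α) := by
  obtain ⟨s, hs⟩ := h
  intro i
  rw [sum_content]
  have : (Finset.univ.filter fun j => α j ∈ Finset.Ioi i).card ≤ (Finset.Ioi i).card := by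
    refine Finset.card_le_card_of_injOn s ?_ hs.injective.injOn
    intro j hj
    simp only [Finset.coe_filter, Finset.mem_univ, true_and, Set.mem_ofPred_eq,
      Finset.mem_Ioi] at hj
    simpa using hj.trans_le (hs.le j)
  rw [Fin.card_Ioi] at this
  omega

/-- If the ballot condition holds, then a car finds a spot whenever all earlier cars did. -/
theorem exists_free_spot (hα : IsBallotContent (content α)) (i : Fin n)
    (hs : ∀ j < i, IsLeast {p : Fin n | α j ≤ p ∧ ∀ l < j, s l ≠ p} (s j)) :
    ∃ p, α i ≤ p ∧ ∀ j < i, s j ≠ p := by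
  by_contra! hfull
  have hfree : {p | ∀ j < i, s j ≠ p}.Nonempty := by
    by_contra hne
    rw [Set.not_nonempty_iff_eq_empty, Set.eq_empty_iff_forall_notMem] at hne
    have hsub : (Finset.univ : Finset (Fin n)) ⊆ (Finset.Iio i).image s := by
      intro p _
      have := hne p
      simp only [Set.mem_ofPred_eq, not_forall, not_not] at this
      obtain ⟨j, hj, rfl⟩ := this
      exact Finset.mem_image_of_mem s (Finset.mem_Iio.mpr hj)
    have := (Finset.card_le_card hsub).trans Finset.card_image_le
    rw [Finset.card_univ, Fintype.card_fin, Fin.card_Iio] at this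
    omega
  -- Let `p` be the last free spot. Every spot beyond `p` is held by a car preferring a spot beyond
  -- `p`, since otherwise it would have taken `p`. Car `i` is one more such car, which violates the
  -- ballot condition at `p`.
  obtain ⟨p, hp⟩ := (Set.toFinite _).exists_maximal hfree
  have hpα : p < α i := by
    by_contra! hle
    obtain ⟨j, hj, hjp⟩ := hfull p hle
    exact hp.prop j hj hjp
  have hsub : Finset.Ioi p ⊆ (Finset.univ.filter fun j => j < i ∧ p < α j).image s := by
    intro r hr
    rw [Finset.mem_Ioi] at hr
    have : r ∉ {p | ∀ j < i, s j ≠ p} := fun hmem => (hp.le_of_ge hmem hr.le).not_gt hr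
    simp only [Set.mem_ofPred_eq, not_forall, not_not] at this
    obtain ⟨j, hj, rfl⟩ := this
    refine Finset.mem_image_of_mem s ?_
    simp only [Finset.mem_filter, Finset.mem_univ, true_and]
    refine ⟨hj, ?_⟩
    by_contra! hle
    exact ((hs j hj).2 ⟨hle, fun l hl => hp.prop l (hl.trans hj)⟩).not_gt hr
  have h1 := (Finset.card_le_card hsub).trans Finset.card_image_le
  have h2 : (Finset.univ.filter fun j => j < i ∧ p < α j).card <
      (Finset.univ.filter fun j => α j ∈ Finset.Ioi p).card := by
    refine Finset.card_lt_card (Finset.ssubset_iff_of_subset ?_ |>.mpr ⟨i, ?_, ?_⟩)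
    · intro j
      simp +contextual
    · simpa using hpα
    · simp
  have h3 := hα p
  rw [sum_content] at h3
  rw [Fin.card_Ioi] at h1
  omega

theorem IsBallotContent.isPF (hα : IsBallotContent (content α)) : IsPF α := by
  have key : ∀ k ≤ n, ∃ s : Fin n → Fin n, ∀ i : Fin n, (i : ℕ) < k →
      IsLeast {p : Fin n | α i ≤ p ∧ ∀ j < i, s j ≠ p} (s i) := by
    intro k hk
    induction k with
    | zero => exact ⟨α, fun i hi => absurd hi (Nat.not_lt_zero _)⟩
    | succ k ih =>
      obtain ⟨s, hs⟩ := ih (by omega)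
      set c : Fin n := ⟨k, hk⟩
      obtain ⟨p, hp⟩ := exists_isLeast_of_nonempty
        (exists_free_spot hα c fun j hj => hs j hj)
      refine ⟨Function.update s c p, fun i hi => ?_⟩
      have hic : i ≤ c := Nat.lt_succ_iff.mp hi
      have heq : {r : Fin n | α i ≤ r ∧ ∀ j < i, Function.update s c p j ≠ r} =
          {r : Fin n | α i ≤ r ∧ ∀ j < i, s j ≠ r} := by
        ext r
        refine and_congr_right fun _ => forall₂_congr fun j hj => ?_
        rw [Function.update_of_ne (hj.trans_le hic).ne]
      rw [heq]
      rcases hic.eq_or_lt with rfl | hlt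
      · rw [Function.update_self]
        exact hp
      · rw [Function.update_of_ne hlt.ne]
        exact hs i hlt
  obtain ⟨s, hs⟩ := key n le_rfl
  exact ⟨s, fun i => hs i i.isLt⟩

theorem isPF_iff : IsPF α ↔ IsBallotContent (content α) :=
  ⟨IsPF.isBallotContent, IsBallotContent.isPF⟩

end Parking

/-! ### Unit interval parking functions and rankings. -/

section UnitInterval

variable {n : ℕ} {w α s : Fin n → Fin n}

/-- The number of earlier occurrences of the letter at position `i`. -/
def occRank (w : Fin n → Fin n) (i : Fin n) : ℕ :=
  (Finset.univ.filter fun j => j < i ∧ w j = w i).card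

theorem occRank_lt_content (w : Fin n → Fin n) (i : Fin n) : occRank w i < content w (w i) := by
  refine Finset.card_lt_card (Finset.ssubset_iff_of_subset ?_ |>.mpr ⟨i, ?_, ?_⟩)
  · intro j
    simp +contextual
  · simp
  · simp

theorem occRank_lt_occRank {i j : Fin n} (hij : i < j) (hw : w i = w j) :
    occRank w i < occRank w j := by
  refine Finset.card_lt_card (Finset.ssubset_iff_of_subset ?_ |>.mpr ⟨i, ?_, ?_⟩)
  · intro l
    simp only [Finset.mem_filter, Finset.mem_univ, true_and]
    exact fun h => ⟨h.1.trans hij, h.2.trans hw⟩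
  · simp [hij, hw]
  · simp

theorem exists_occRank_eq_zero (w : Fin n → Fin n) (i : Fin n) :
    ∃ j, w j = w i ∧ occRank w j = 0 := by
  obtain ⟨j, hj⟩ := exists_isLeast_of_nonempty (S := {j | w j = w i}) ⟨i, rfl⟩
  refine ⟨j, hj.1, ?_⟩
  rw [occRank, Finset.card_eq_zero, Finset.filter_eq_empty_iff]
  rintro l - ⟨hlt, hl⟩
  exact (hj.2 (hl.trans hj.1)).not_gt hlt

theorem exists_occRank_add_one {i : Fin n} (hi : occRank w i ≠ 0) :
    ∃ j < i, w j = w i ∧ occRank w j + 1 = occRank w i := by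
  have hne : {j | j < i ∧ w j = w i}.Nonempty := by
    obtain ⟨j, hj⟩ := Finset.card_ne_zero.mp hi
    exact ⟨j, by simpa using hj⟩
  obtain ⟨j, hj⟩ := (Set.toFinite _).exists_maximal hne
  refine ⟨j, hj.prop.1, hj.prop.2, ?_⟩
  have : (Finset.univ.filter fun l => l < i ∧ w l = w i) =
      insert j (Finset.univ.filter fun l => l < j ∧ w l = w j) := by
    ext l
    simp only [Finset.mem_filter, Finset.mem_univ, true_and, Finset.mem_insert]
    constructor
    · intro hl
      rcases lt_trichotomy l j with h | h | h
      · exact Or.inr ⟨h, hl.2.trans hj.prop.2.symm⟩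
      · exact Or.inl h
      · exact absurd h (hj.le_of_ge hl h.le).not_gt
    · rintro (rfl | hl)
      · exact hj.prop
      · exact ⟨hl.1.trans hj.prop.1, hl.2.trans hj.prop.2⟩
  rw [occRank, occRank, this, Finset.card_insert_of_notMem (by simp)]

theorem content_apply_ne_zero (w : Fin n → Fin n) (i : Fin n) : content w (w i) ≠ 0 :=
  Nat.ne_zero_of_lt (occRank_lt_content w i)

theorem add_content_le (hw : IsRankingContent (content w)) {i j : Fin n} (hij : w i < w j) :
    (w i : ℕ) + content w (w i) ≤ w j := by
  have hi := hw (w i) (content_apply_ne_zero w i)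
  have hj := hw (w j) (content_apply_ne_zero w j)
  have : content w (w i) + ∑ b ∈ Finset.Ici (w j), content w b ≤
      ∑ b ∈ Finset.Ici (w i), content w b := by
    rw [← Finset.sum_insert (by simpa using hij)]
    refine Finset.sum_le_sum_of_subset fun b hb => ?_
    simp only [Finset.mem_insert, Finset.mem_Ici] at hb ⊢
    rcases hb with rfl | hb
    · exact le_rfl
    · exact hij.le.trans hb
  omega

theorem add_occRank_lt (hw : IsRankingContent (content w)) {i j : Fin n} (hij : w i < w j) :
    (w i : ℕ) + occRank w i < w j := by
  have := add_content_le hw hij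
  have := occRank_lt_content w i
  omega

theorem add_occRank_lt_length (hw : IsRankingContent (content w)) (i : Fin n) :
    (w i : ℕ) + occRank w i < n := by
  have hi := hw (w i) (content_apply_ne_zero w i)
  have := occRank_lt_content w i
  have : content w (w i) ≤ ∑ b ∈ Finset.Ici (w i), content w b :=
    Finset.single_le_sum (f := content w) (fun _ _ => Nat.zero_le _) (by simp)
  omega

/-- The outcome of the unit interval parking function attached to a ranking `w`. -/
def rankingSpot (w : Fin n → Fin n) (hw : IsRankingContent (content w)) (i : Fin n) : Fin n :=
  ⟨w i + occRank w i, add_occRank_lt_length hw i⟩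

/-- The unit interval parking function attached to a ranking `w`: the cars with the same letter
occupy a block of consecutive spots which starts at that letter. -/
def rankingPref (w : Fin n → Fin n) (hw : IsRankingContent (content w)) (i : Fin n) : Fin n :=
  ⟨w i + (occRank w i - 1), by have := add_occRank_lt_length hw i; omega⟩

theorem rankingSpot_injective (hw : IsRankingContent (content w)) :
    Function.Injective (rankingSpot w hw) := by
  intro i j hij
  have hij : (w i : ℕ) + occRank w i = w j + occRank w j := congrArg Fin.val hij
  rcases lt_trichotomy (w i) (w j) with h | h | h
  · have := add_occRank_lt hw h
    omega
  · rcases lt_trichotomy i j with hlt | heq | hlt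
    · have := occRank_lt_occRank hlt h
      rw [h] at hij
      omega
    · exact heq
    · have := occRank_lt_occRank hlt h.symm
      rw [h] at hij
      omega
  · have := add_occRank_lt hw h
    omega

/-- The first car of a block prefers the block's first spot (truncated subtraction); each later one
prefers the spot of its predecessor in the block, so it moves on by one. -/
theorem isParking_rankingPref (hw : IsRankingContent (content w)) :
    IsParking (rankingPref w hw) (rankingSpot w hw) := by
  intro i
  refine ⟨⟨?_, fun j hj h => hj.ne (rankingSpot_injective hw h)⟩, ?_⟩
  · simp only [rankingPref, rankingSpot, Fin.mk_le_mk]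
    omega
  · rintro p ⟨hp, hfree⟩
    simp only [rankingPref, rankingSpot, Fin.le_def] at hp ⊢
    by_cases h0 : occRank w i = 0
    · omega
    · obtain ⟨j, hj, hwj, hr⟩ := exists_occRank_add_one h0
      have hne : (w j : ℕ) + occRank w j ≠ p := fun h => hfree j hj (Fin.ext h)
      rw [hwj] at hne
      omega

theorem isUPF_rankingPref (hw : IsRankingContent (content w)) : IsUPF (rankingPref w hw) := by
  refine ⟨_, isParking_rankingPref hw, fun i => ?_⟩
  simp only [rankingPref, rankingSpot]
  omega

/-- Different letters give disjoint blocks in the same order, and within a block preferences weakly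
increase with arrival time. -/
theorem inv_rankingPref (hw : IsRankingContent (content w)) : inv (rankingPref w hw) = inv w := by
  unfold inv
  congr 1
  refine Finset.filter_congr ?_
  rintro ⟨i, j⟩ -
  refine and_congr_right fun hij => ?_
  simp only at hij
  simp only [rankingPref, Fin.mk_lt_mk]
  rcases lt_trichotomy (w i) (w j) with h | h | h
  · have := add_occRank_lt hw h
    simp only [h.not_gt, iff_false]
    omega
  · have := occRank_lt_occRank hij h
    simp only [h, lt_irrefl, iff_false]
    omega
  · have := add_occRank_lt hw h
    simp only [h, iff_true]
    omega

theorem not_lt_of_rankingPref_eq {w' : Fin n → Fin n} (hw : IsRankingContent (content w))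
    (hw' : IsRankingContent (content w')) (h : rankingPref w hw = rankingPref w' hw')
    (i : Fin n) : ¬ w i < w' i := by
  intro hlt
  have hspot : rankingSpot w hw = rankingSpot w' hw' :=
    (isParking_rankingPref hw).unique (h ▸ isParking_rankingPref hw')
  -- Car `j` opens the block of `i` in `w'`, so it parks where it prefers; this forces it to open a
  -- block at the same spot in `w`.
  obtain ⟨j, hj, hj0⟩ := exists_occRank_eq_zero w' i
  have hsi : (w i : ℕ) + occRank w i = w' i + occRank w' i := congrArg Fin.val (congrFun hspot i)
  have hsj : (w j : ℕ) + occRank w j = w' j + occRank w' j := congrArg Fin.val (congrFun hspot j)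
  have hpj : (w j : ℕ) + (occRank w j - 1) = w' j + (occRank w' j - 1) :=
    congrArg Fin.val (congrFun h j)
  have hle : w j ≤ w i := by
    by_contra! hgt
    have := add_occRank_lt hw hgt
    rw [hj] at hsj
    omega
  rw [hj] at hsj hpj
  omega

theorem rankingPref_injective {w' : Fin n → Fin n} (hw : IsRankingContent (content w))
    (hw' : IsRankingContent (content w')) (h : rankingPref w hw = rankingPref w' hw') :
    w = w' := by
  funext i
  exact le_antisymm (not_lt.mp (not_lt_of_rankingPref_eq hw' hw h.symm i))
    (not_lt.mp (not_lt_of_rankingPref_eq hw hw' h i))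

theorem card_filter_mem_of_bijective (hs : Function.Bijective s) (t : Finset (Fin n)) :
    (Finset.univ.filter fun j => s j ∈ t).card = t.card := by
  refine Finset.card_bij (fun j _ => s j) (by simp) (fun _ _ _ _ h => hs.1 h) fun p hp => ?_
  obtain ⟨j, rfl⟩ := hs.2 p
  exact ⟨j, by simpa using hp, rfl⟩

theorem IsParking.exists_lt_of_ne (h : IsParking α s) {i : Fin n} (hi : α i ≠ s i) :
    ∃ j < i, s j = α i := by
  by_contra! hfree
  exact hi (le_antisymm (h.le i) ((h i).2 ⟨le_rfl, hfree⟩))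

theorem IsUPF.exists_rankingPref_eq (h : IsUPF α) :
    ∃ (w : Fin n → Fin n) (hw : IsRankingContent (content w)), rankingPref w hw = α := by
  obtain ⟨s, hs, hunit⟩ := h
  have hbij : Function.Bijective s := ⟨hs.injective, hs.surjective⟩
  have hle (i : Fin n) : (α i : ℕ) ≤ s i := hs.le i
  -- Call a car lucky if it gets its preferred spot. Lucky spots start the blocks, so the letter of
  -- `i` is the last lucky spot at or before `s i`; spot `0` is always lucky.
  have hex (i : Fin n) : ∃ p, p ≤ s i ∧ (∃ j, s j = p ∧ α j = p) ∧
      ∀ j, α j = s j → s j ≤ s i → s j ≤ p := by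
    have hne : {p | p ≤ s i ∧ ∃ j, s j = p ∧ α j = p}.Nonempty := by
      have hn : 0 < n := i.pos
      obtain ⟨j, hj⟩ := hs.surjective ⟨0, hn⟩
      refine ⟨⟨0, hn⟩, Nat.zero_le _, j, hj, ?_⟩
      have := hle j
      rw [hj] at this
      exact Fin.ext (Nat.le_zero.mp this)
    obtain ⟨p, hp⟩ := (Set.toFinite _).exists_maximal hne
    refine ⟨p, hp.prop.1, hp.prop.2, fun j hj hji => ?_⟩
    exact (le_total (s j) p).elim id (hp.le_of_ge ⟨hji, j, rfl, hj⟩)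
  choose w hws hwl hwmax using hex
  have hmono {i j : Fin n} (hij : w i ≤ s j) : w i ≤ w j := by
    obtain ⟨l, hl, hl'⟩ := hwl i
    rw [← hl] at hij ⊢
    exact hwmax j l (hl'.trans hl.symm) hij
  have hblock {i j : Fin n} (h1 : w i ≤ s j) (h2 : s j ≤ s i) : w j = w i :=
    le_antisymm (hmono ((hws j).trans h2)) (hmono h1)
  have hunlucky {i : Fin n} (hi : w i < s i) : ∃ j < i, (s j : ℕ) + 1 = s i ∧ s j = α i := by
    have hne : α i ≠ s i := fun h => (hwmax i i h le_rfl).not_gt hi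
    obtain ⟨j, hj, hji⟩ := hs.exists_lt_of_ne hne
    refine ⟨j, hj, ?_, hji⟩
    have h1 := hunit i
    have h2 := hle i
    have h3 : (α i : ℕ) ≠ s i := fun h => hne (Fin.ext h)
    rw [hji]
    omega
  -- An unlucky car was displaced by an earlier car just before it, so each block fills from left to
  -- right.
  have horder : ∀ d : ℕ, ∀ i j : Fin n, (s j : ℕ) = s i + d + 1 → w i = w j → i < j := by
    intro d
    induction d with
    | zero =>
      intro i j hd hij
      have h1 : w i ≤ s i := hws i
      obtain ⟨l, hl, hl1, -⟩ := hunlucky (i := j) (by rw [← hij, Fin.lt_def]; omega)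
      have : l = i := hs.injective (Fin.ext (by omega))
      exact this ▸ hl
    | succ d ih =>
      intro i j hd hij
      have h1 : w i ≤ s i := hws i
      obtain ⟨l, hl, hl1, -⟩ := hunlucky (i := j) (by rw [← hij, Fin.lt_def]; omega)
      refine (ih i l (by omega) ?_).trans hl
      rw [hij]
      exact (hblock (by rw [← hij, Fin.le_def]; omega) (by rw [Fin.le_def]; omega)).symm
  have horder' {i j : Fin n} (hlt : s i < s j) (hij : w i = w j) : i < j :=
    horder (s j - s i - 1) i j (by rw [Fin.lt_def] at hlt; omega) hij
  have hrank (i : Fin n) : occRank w i = s i - w i := by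
    rw [← Fin.card_Ico, ← card_filter_mem_of_bijective hbij, occRank]
    congr 1
    refine Finset.filter_congr fun j _ => ?_
    rw [Finset.mem_Ico]
    constructor
    · rintro ⟨hlt, hj⟩
      refine ⟨hj ▸ hws j, ?_⟩
      by_contra! hge
      rcases hge.eq_or_lt with heq | hgt
      · exact hlt.ne' (hs.injective heq)
      · exact hlt.not_gt (horder' hgt hj.symm)
    · rintro ⟨h1, h2⟩
      exact ⟨horder' h2 (hblock h1 h2.le), hblock h1 h2.le⟩
  have hw : IsRankingContent (content w) := by
    intro a ha
    obtain ⟨i, hi⟩ := Finset.card_ne_zero.mp ha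
    obtain rfl : w i = a := by simpa using hi
    have : (Finset.univ.filter fun j => w j ∈ Finset.Ici (w i)) =
        Finset.univ.filter fun j => s j ∈ Finset.Ici (w i) := by
      refine Finset.filter_congr fun j _ => ?_
      simp only [Finset.mem_Ici]
      exact ⟨fun h => h.trans (hws j), fun h => hmono h⟩
    rw [sum_content, this, card_filter_mem_of_bijective hbij, Fin.card_Ici]
    omega
  refine ⟨w, hw, funext fun i => Fin.ext ?_⟩
  simp only [rankingPref, hrank]
  rcases (hws i).eq_or_lt with heq | hlt
  · obtain ⟨l, hl, hl'⟩ := hwl i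
    obtain rfl : l = i := hs.injective (hl.trans heq)
    rw [hl', ← heq]
    omega
  · obtain ⟨j, -, hj1, hj2⟩ := hunlucky hlt
    rw [← hj2]
    rw [Fin.lt_def] at hlt
    omega

end UnitInterval

/-! ### Assembling the generating functions and specializing `q`. -/

section Enumerators

variable {K : Type*} [Field K]

theorem PF_eq_filter_content (n : ℕ) [DecidablePred fun α : Fin n → Fin n =>
    IsBallotContent (content α)] :
    PF n = Finset.univ.filter fun α : Fin n → Fin n => IsBallotContent (content α) := by
  ext α
  simp [PF, isPF_iff]

theorem sum_PF_div_qFactorial {q : K} (hq : ∀ n, qFactorial q n ≠ 0) (n : ℕ) :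
    (∑ α ∈ PF n, q ^ inv α) / qFactorial q n =
      contentSum (fun i => 1 / qFactorial q i) (IsBallotContent (k := n)) n := by
  classical
  rw [PF_eq_filter_content, ← sum_wordInv_div_qFactorial hq]
  rfl

theorem sum_UPF_eq_sum_ranking (q : K) (n : ℕ) [DecidablePred fun w : Fin n → Fin n =>
    IsRankingContent (content w)] :
    ∑ α ∈ UPF n, q ^ inv α =
      ∑ w : Fin n → Fin n with IsRankingContent (content w), q ^ inv w := by
  symm
  refine Finset.sum_bij (fun w hw => rankingPref w (Finset.mem_filter.mp hw).2) ?_ ?_ ?_ ?_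
  · intro w hw
    simpa [UPF] using isUPF_rankingPref _
  · intro w hw w' hw' h
    exact rankingPref_injective _ _ h
  · intro α hα
    obtain ⟨w, hw, rfl⟩ := IsUPF.exists_rankingPref_eq (α := α) (by simpa [UPF] using hα)
    exact ⟨w, by simpa using hw, rfl⟩
  · intro w hw
    rw [inv_rankingPref]

theorem sum_UPF_div_qFactorial {q : K} (hq : ∀ n, qFactorial q n ≠ 0) (n : ℕ) :
    (∑ α ∈ UPF n, q ^ inv α) / qFactorial q n =
      contentSum (fun i => 1 / qFactorial q i) (IsRankingContent (k := n)) n := by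
  classical
  rw [sum_UPF_eq_sum_ranking, ← sum_wordInv_div_qFactorial hq]
  rfl

theorem constantCoeff_qexp (q : K) : constantCoeff (qexp q) = 1 := by
  simp [qexp, ← coeff_zero_eq_constantCoeff_apply, qFactorial_zero]

theorem coeff_qexp (q : K) (n : ℕ) : coeff n (qexp q) = 1 / qFactorial q n := by
  simp [qexp]

theorem isCompInverse_PF {q : K} (hq : ∀ n, qFactorial q n ≠ 0) :
    IsCompInverse (X * mk fun n => (∑ α ∈ PF n, q ^ inv α) / qFactorial q n)
      (X * rescale (-1) (qExp q)) := by
  simp only [sum_PF_div_qFactorial hq, ← coeff_qexp]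
  exact isCompInverse_mk_contentSum_ballot (constantCoeff_qexp q) (qexp_mul_rescale_qExp hq)

theorem mk_UPF {q : K} (hq : ∀ n, qFactorial q n ≠ 0) :
    (mk fun n => (∑ α ∈ UPF n, q ^ inv α) / qFactorial q n) = (2 - qexp q)⁻¹ := by
  simp only [sum_UPF_div_qFactorial hq, ← coeff_qexp]
  exact mk_contentSum_ranking (constantCoeff_qexp q)

theorem qFactorial_ratFunc_X_ne_zero (n : ℕ) : qFactorial (RatFunc.X : RatFunc ℚ) n ≠ 0 := by
  refine Finset.prod_ne_zero_iff.mpr fun i _ h => ?_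
  have hp : qNumber (RatFunc.X : RatFunc ℚ) (i + 1) =
      algebraMap (Polynomial ℚ) (RatFunc ℚ) (∑ j ∈ Finset.range (i + 1), Polynomial.X ^ j) := by
    simp [qNumber]
  rw [hp, map_eq_zero_iff _ (RatFunc.algebraMap_injective ℚ)] at h
  -- At `q = 1` the `q`-number is `i + 1`, nonzero in `ℚ`.
  have := congrArg (Polynomial.eval 1) h
  simp only [Polynomial.eval_finsetSum, Polynomial.eval_pow, Polynomial.eval_X, one_pow,
    Finset.sum_const, Finset.card_range, nsmul_eq_mul, mul_one, Polynomial.eval_zero] at this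
  exact Nat.cast_ne_zero.mpr (Nat.succ_ne_zero i) this

theorem qFactorial_one_eq_factorial (n : ℕ) : qFactorial (1 : ℚ) n = n.factorial := by
  induction n with
  | zero => simp [qFactorial_zero]
  | succ n ih =>
    rw [qFactorial_succ, ih, Nat.factorial_succ]
    simp [qNumber, mul_comm]

theorem qexp_one : qexp (1 : ℚ) = exp ℚ := by
  ext n
  simp [coeff_qexp, qFactorial_one_eq_factorial, coeff_exp]

theorem qExp_one : qExp (1 : ℚ) = exp ℚ := by
  ext n
  simp [qExp, qFactorial_one_eq_factorial, coeff_exp]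

end Enumerators

end ParkingFunctions

/-- The first two identities are formal: `q` is an indeterminate, namely the generator of `ℚ(q)`,
and the power series have coefficients in `ℚ(q)`.  The last two are their classical counterparts. -/
theorem mainTheorem1 :
    (ParkingFunctions.IsCompInverse
      (PowerSeries.X * PowerSeries.mk fun n : ℕ =>
        Polynomial.aeval (RatFunc.X : RatFunc ℚ) (ParkingFunctions.PFpoly n) /
          ParkingFunctions.qFactorial (RatFunc.X : RatFunc ℚ) n)
      (PowerSeries.X *
        PowerSeries.rescale (-1) (ParkingFunctions.qExp (RatFunc.X : RatFunc ℚ)))) ∧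
    ((PowerSeries.mk fun n : ℕ =>
        Polynomial.aeval (RatFunc.X : RatFunc ℚ) (ParkingFunctions.UPFpoly n) /
          ParkingFunctions.qFactorial (RatFunc.X : RatFunc ℚ) n) =
      (2 - ParkingFunctions.qexp (RatFunc.X : RatFunc ℚ))⁻¹) ∧
    (ParkingFunctions.IsCompInverse
      (PowerSeries.X * PowerSeries.mk fun n : ℕ =>
        ((ParkingFunctions.PF n).card : ℚ) / (n.factorial : ℚ))
      (PowerSeries.X * PowerSeries.rescale (-1) (PowerSeries.exp ℚ))) ∧
    ((PowerSeries.mk fun n : ℕ =>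
        ((ParkingFunctions.UPF n).card : ℚ) / (n.factorial : ℚ)) =
      (2 - PowerSeries.exp ℚ)⁻¹) := by
  have hq := ParkingFunctions.qFactorial_ratFunc_X_ne_zero
  have h1 (n : ℕ) : ParkingFunctions.qFactorial (1 : ℚ) n ≠ 0 := by
    rw [ParkingFunctions.qFactorial_one_eq_factorial]
    exact Nat.cast_ne_zero.mpr n.factorial_ne_zero
  refine ⟨?_, ?_, ?_, ?_⟩
  · simpa [ParkingFunctions.PFpoly] using ParkingFunctions.isCompInverse_PF hq
  · simpa [ParkingFunctions.UPFpoly] using ParkingFunctions.mk_UPF hq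
  · simpa [ParkingFunctions.qFactorial_one_eq_factorial, ParkingFunctions.qExp_one] using
      ParkingFunctions.isCompInverse_PF h1
  · simpa [ParkingFunctions.qFactorial_one_eq_factorial, ParkingFunctions.qexp_one] using
      ParkingFunctions.mk_UPF h1
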